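/- For integers $r$ and $m\ge 1$, $n\ge 0$ let $$\mathcal H_{r,m}(n)=\sum_{\substack{1\le k\le n\\ k\equiv r\ (\mathrm{mod}\ m)}}\frac1k .$$ Let $F_0=0$, $F_1=1$, $F_n=F_{n-1}+F_{n-2}$ ($n\ge 2$) be the Fibonacci numbers and let $\left(\frac{\cdot}{p}\right)$ be the Legendre symbol. For rational numbers $x,y$ and a positive integer $N$, write $x\equiv y\pmod N$ if $x-y=N\cdot\frac ab$ for some integers $a$ and $b\neq 0$ with $b$ coprime to $N$. Then for every prime $p>5$, $$\mathcal H_{p,5}(p-1)\equiv \frac{5^{\frac{p-1}{2}}F_p-1}{p}-\frac{5^{p-1}F_{2p-\left(\frac 5p\right)}-1}{4p}\pmod{p^2}.$$ -/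

import Mathlib

/-- Congruence of rational numbers modulo a natural number `N`: the difference is `N` times a
fraction whose denominator is coprime to `N`. -/
def RatModEq (N : ℕ) (x y : ℚ) : Prop :=
  ∃ a b : ℤ, b ≠ 0 ∧ IsCoprime b (N : ℤ) ∧ x - y = (N : ℚ) * ((a : ℚ) / (b : ℚ))

/-- The lacunary harmonic sum: the sum of `1 / k` over `1 ≤ k ≤ n` with `k ≡ r (mod m)`. -/
def lacunaryHarmonic (r : ℤ) (m n : ℕ) : ℚ :=
  ∑ k ∈ (Finset.Icc 1 n).filter (fun k : ℕ => (k : ℤ) ≡ r [ZMOD (m : ℤ)]), 1 / (k : ℚ)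

/-! With T_a(k) = (1/k)(1 - a p H_{k-1}) (`truncatedInv`), the product formula for binomial
coefficients gives (-1)^k C(ap,k) ≡ -a p T_a(k) mod p^3 for 0 < k < p. The harmonic term cancels in
1/k = 2 T_2(k) - T_4(k), so the lacunary sum is a combination of sums of T_2 and T_4 over the class
of p mod 5, that is, of alternating binomial sums for 2p and 4p. These two sums give the two
Fibonacci quotients separately.

The full class sums A_n(s) of (-1)^k C(n,k) are Fibonacci numbers times powers of 5
(`altChooseSum_four_mul`). For n = 2p and s = p, the symmetry k ↦ 2p - k makes A_n(s) twice the sum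
over k < p, up to C(2p,p) ≡ 2 mod p^3.

For n = 4p, the range is cut into blocks of length p, and symmetry leaves the blocks k and p + k
with k < p. The second block is again expressed by T_4, with a correction p/k^2
(`neg_one_pow_mul_choose_prime_add_modEq`). In 3 A(0) + 2 A(p), the reflection k ↦ p - k and the
vanishing of ∑ 1/k^2 mod p remove every class sum except that of T_4 over the class of p. -/

/-- The subring of `ℚ` of fractions whose denominator is prime to `p`. -/
noncomputable def pIntegers (p : ℕ) [Fact p.Prime] : Subring ℚ := (Rat.padicValuation p).integer

theorem mem_pIntegers_iff {p : ℕ} [Fact p.Prime] {x : ℚ} :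
    x ∈ pIntegers p ↔ ¬ p ∣ x.den := Rat.padicValuation_le_one_iff

/-- Congruence of rational numbers modulo `p ^ n`, relative to the ring of `p`-integers. -/
def PModEq (p : ℕ) [Fact p.Prime] (n : ℕ) (x y : ℚ) : Prop :=
  ∃ z ∈ pIntegers p, x - y = (p : ℚ) ^ n * z

theorem natCast_mem_pIntegers {p : ℕ} [Fact p.Prime] (n : ℕ) : (n : ℚ) ∈ pIntegers p :=
  natCast_mem _ n

theorem inv_mem_pIntegers {p : ℕ} [hp : Fact p.Prime] {k : ℕ} (hk : ¬ p ∣ k) :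
    (1 / (k : ℚ)) ∈ pIntegers p := by
  rw [mem_pIntegers_iff]
  intro h
  apply hk
  have hk0 : k ≠ 0 := by rintro rfl; simp at hk
  have : (1 / (k : ℚ)).den = k := by
    rw [one_div, Rat.inv_natCast_den]; simp [hk0]
  rwa [this] at h

theorem inv_mem_of_lt {p : ℕ} [hp : Fact p.Prime] {k : ℕ} (hk : 0 < k) (hkp : k < p) :
    (1 / (k : ℚ)) ∈ pIntegers p :=
  inv_mem_pIntegers fun h => absurd (Nat.le_of_dvd hk h) (by omega)

theorem exists_mul_one_add_eq_one {p : ℕ} [hp : Fact p.Prime] {x : ℚ} (hx : x ∈ pIntegers p) :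
    ∃ u ∈ pIntegers p, u * (1 + p * x) = 1 := by
  have hv : Rat.padicValuation p (p * x) < 1 := by
    rw [map_mul]
    have h1 : Rat.padicValuation p (p : ℚ) < 1 := by
      rw [Rat.padicValuation_self, ← WithZero.exp_zero, WithZero.exp_lt_exp]
      norm_num
    exact mul_lt_one_of_lt_of_le h1 hx
  have h1 : Rat.padicValuation p (1 + p * x) = 1 := Valuation.map_one_add_of_lt _ hv
  have h0 : 1 + p * x ≠ 0 := by
    intro h
    rw [h, map_zero] at h1
    exact zero_ne_one h1
  refine ⟨(1 + p * x)⁻¹, ?_, inv_mul_cancel₀ h0⟩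
  change Rat.padicValuation p (1 + p * x)⁻¹ ≤ 1
  rw [map_inv₀, h1, inv_one]

/-! ### Calculus of congruences modulo powers of p. -/

namespace PModEq

variable {p : ℕ} [hp : Fact p.Prime] {n : ℕ} {x y z w : ℚ}

theorem refl (x : ℚ) : PModEq p n x x := ⟨0, zero_mem _, by ring⟩

/-- Only the difference of the two sides matters. Sums of congruences can thus be rearranged by one
ring identity, even when the terms are not p-integral. -/
theorem of_eq (h : PModEq p n x y) (e : x - y = z - w) : PModEq p n z w := by
  obtain ⟨a, ha, h⟩ := h
  exact ⟨a, ha, by rw [← e, h]⟩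

theorem symm (h : PModEq p n x y) : PModEq p n y x := by
  obtain ⟨a, ha, h⟩ := h
  exact ⟨-a, neg_mem ha, by linear_combination -h⟩

theorem trans (h : PModEq p n x y) (h' : PModEq p n y z) : PModEq p n x z := by
  obtain ⟨a, ha, h⟩ := h
  obtain ⟨b, hb, h'⟩ := h'
  exact ⟨a + b, add_mem ha hb, by linear_combination h + h'⟩

theorem add (h : PModEq p n x y) (h' : PModEq p n z w) : PModEq p n (x + z) (y + w) := by
  obtain ⟨a, ha, h⟩ := h
  obtain ⟨b, hb, h'⟩ := h'
  exact ⟨a + b, add_mem ha hb, by linear_combination h + h'⟩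

theorem sub (h : PModEq p n x y) (h' : PModEq p n z w) : PModEq p n (x - z) (y - w) := by
  obtain ⟨a, ha, h⟩ := h
  obtain ⟨b, hb, h'⟩ := h'
  exact ⟨a - b, sub_mem ha hb, by linear_combination h - h'⟩

theorem mul_left (hz : z ∈ pIntegers p) (h : PModEq p n x y) : PModEq p n (z * x) (z * y) := by
  obtain ⟨a, ha, h⟩ := h
  exact ⟨z * a, mul_mem hz ha, by linear_combination z * h⟩

theorem mul_right (hz : z ∈ pIntegers p) (h : PModEq p n x y) : PModEq p n (x * z) (y * z) :=
  (h.mul_left hz).of_eq (by ring)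

theorem mul_pow (m : ℕ) (h : PModEq p n x y) :
    PModEq p (m + n) (p ^ m * x) (p ^ m * y) := by
  obtain ⟨a, ha, h⟩ := h
  exact ⟨a, ha, by rw [pow_add]; linear_combination (p : ℚ) ^ m * h⟩

theorem of_mul_pow (m : ℕ) (h : PModEq p (m + n) (p ^ m * x) (p ^ m * y)) :
    PModEq p n x y := by
  have hp0 : (p : ℚ) ^ m ≠ 0 := pow_ne_zero _ (by exact_mod_cast hp.out.ne_zero)
  obtain ⟨a, ha, h⟩ := h
  refine ⟨a, ha, mul_left_cancel₀ hp0 ?_⟩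
  rw [pow_add] at h
  linear_combination h

theorem mono {m : ℕ} (hmn : m ≤ n) (h : PModEq p n x y) : PModEq p m x y := by
  obtain ⟨a, ha, h⟩ := h
  obtain ⟨k, rfl⟩ := Nat.exists_eq_add_of_le hmn
  exact ⟨p ^ k * a, mul_mem (pow_mem (natCast_mem_pIntegers p) k) ha, by rw [h, pow_add]; ring⟩

theorem sum {ι : Type*} (s : Finset ι) {f g : ι → ℚ} (h : ∀ i ∈ s, PModEq p n (f i) (g i)) :
    PModEq p n (∑ i ∈ s, f i) (∑ i ∈ s, g i) := by
  classical
  induction s using Finset.induction_on with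
  | empty => simpa using refl _
  | insert a s ha ih =>
    rw [Finset.sum_insert ha, Finset.sum_insert ha]
    exact (h a (by simp)).add (ih fun i hi => h i (by simp [hi]))

/-- All terms of degree at least two in the expansion carry a factor p^(2n). -/
theorem prod_one_add {ι : Type*} (s : Finset ι) {f : ι → ℚ} (h : ∀ i ∈ s, f i ∈ pIntegers p) :
    PModEq p (n + n) (∏ i ∈ s, (1 + p ^ n * f i)) (1 + p ^ n * ∑ i ∈ s, f i) := by
  classical
  induction s using Finset.induction_on with
  | empty => simpa using refl _
  | insert a s ha ih =>
    rw [Finset.sum_insert ha, Finset.prod_insert ha]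
    have hf := h a (by simp)
    have hm : 1 + p ^ n * f a ∈ pIntegers p :=
      add_mem (one_mem _) (mul_mem (pow_mem (natCast_mem_pIntegers p) n) hf)
    refine ((ih fun i hi => h i (by simp [hi])).mul_left hm).trans
      ⟨f a * ∑ i ∈ s, f i, mul_mem hf (sum_mem fun i hi => h i (by simp [hi])), ?_⟩
    rw [pow_add]
    ring

theorem ratModEq (h : PModEq p n x y) : RatModEq (p ^ n) x y := by
  obtain ⟨a, ha, h⟩ := h
  rw [mem_pIntegers_iff] at ha
  refine ⟨a.num, a.den, by simp, ?_, ?_⟩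
  · rw [Nat.isCoprime_iff_coprime]
    exact (((Nat.Prime.coprime_iff_not_dvd hp.out).2 ha).symm).pow_right n
  · rw [h]
    push_cast
    rw [Rat.num_div_den]

end PModEq

/-! ### Harmonic sums modulo p and p^2. -/

theorem PModEq.inv_sq {p : ℕ} [hp : Fact p.Prime] (hp5 : 5 < p) {k : ℕ} (hk : 0 < k)
    (hkp : k < p) : PModEq p 1 (1 / (k : ℚ) ^ 2) ((k ^ (p - 3) : ℕ) : ℚ) := by
  have hk0 : (k : ℚ) ≠ 0 := by exact_mod_cast hk.ne'
  have h : (k : ZMod p) ≠ 0 := by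
    rw [Ne, ZMod.natCast_eq_zero_iff]
    exact fun h => absurd (Nat.le_of_dvd hk h) (by omega)
  have h1 := ZMod.pow_card_sub_one_eq_one h
  have h2 : ((1 - (k : ℤ) ^ (p - 1) : ℤ) : ZMod p) = 0 := by
    push_cast; rw [h1, sub_self]
  rw [ZMod.intCast_zmod_eq_zero_iff_dvd] at h2
  obtain ⟨c, hc⟩ := h2
  refine ⟨1 / k * (1 / k) * c, mul_mem (mul_mem (inv_mem_of_lt hk hkp) (inv_mem_of_lt hk hkp))
    (intCast_mem _ c), ?_⟩
  have hc' : (1 : ℚ) - (k : ℚ) ^ (p - 1) = p * c := by exact_mod_cast hc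
  have e : p - 1 = (p - 3) + 2 := by omega
  rw [e, pow_add] at hc'
  push_cast
  field_simp
  linear_combination hc'

/-- By Fermat, 1/k^2 ≡ k^(p-3), and power sums over a field of p elements vanish for exponents below
p - 1. -/
theorem sum_inv_sq_modEq {p : ℕ} [hp : Fact p.Prime] (hp5 : 5 < p) :
    PModEq p 1 (∑ k ∈ Finset.Ico 1 p, 1 / (k : ℚ) ^ 2) 0 := by
  have h1 : PModEq p 1 (∑ k ∈ Finset.Ico 1 p, 1 / (k : ℚ) ^ 2)
      (∑ k ∈ Finset.Ico 1 p, ((k ^ (p - 3) : ℕ) : ℚ)) := by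
    refine PModEq.sum _ fun k hk => ?_
    rw [Finset.mem_Ico] at hk
    exact PModEq.inv_sq hp5 (by omega) hk.2
  refine h1.trans ?_
  have h2 : ∑ x : ZMod p, x ^ (p - 3) = 0 :=
    FiniteField.sum_pow_lt_card_sub_one (ZMod p) _ (by rw [ZMod.card]; omega)
  have h3 : ∑ x : ZMod p, x ^ (p - 3) = ((∑ k ∈ Finset.range p, k ^ (p - 3) : ℕ) : ZMod p) := by
    push_cast
    rw [Finset.sum_range fun k : ℕ => (k : ZMod p) ^ (p - 3)]
    -- For a literal successor, `ZMod` unfolds to `Fin`, so the two index sets agree.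
    obtain ⟨q, rfl⟩ : ∃ q, p = q + 1 := ⟨p - 1, by omega⟩
    exact Finset.sum_congr rfl fun x _ => by
      congr 1
      exact (ZMod.natCast_zmod_val x).symm
  rw [h3, ZMod.natCast_eq_zero_iff] at h2
  obtain ⟨c, hc⟩ := h2
  rw [Finset.sum_range_eq_add_Ico _ (by omega), zero_pow (by omega), zero_add] at hc
  refine ⟨c, natCast_mem_pIntegers c, ?_⟩
  rw [← Nat.cast_sum, hc]
  push_cast
  ring

/-- The harmonic sum over `1 ≤ i < k`. -/
def harmonicBelow (k : ℕ) : ℚ := ∑ i ∈ Finset.Ico 1 k, 1 / (i : ℚ)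

theorem harmonicBelow_mem {p : ℕ} [hp : Fact p.Prime] {k : ℕ} (hk : k ≤ p) :
    harmonicBelow k ∈ pIntegers p :=
  sum_mem fun i hi => by
    rw [Finset.mem_Ico] at hi
    exact inv_mem_of_lt (by omega) (by omega)

theorem inv_sub_modEq {p : ℕ} [hp : Fact p.Prime] {k : ℕ} (hk : 0 < k) (hkp : k < p) :
    PModEq p 2 (1 / ((p - k : ℕ) : ℚ)) (-(1 / k) - p * (1 / (k : ℚ) ^ 2)) := by
  have hk0 : (k : ℚ) ≠ 0 := by exact_mod_cast hk.ne'
  have hk1 : ((p - k : ℕ) : ℚ) ≠ 0 := by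
    have : p - k ≠ 0 := by omega
    exact_mod_cast this
  have hmk := inv_mem_of_lt (p := p) hk hkp
  have hmk' := inv_mem_of_lt (p := p) (k := p - k) (by omega) (by omega)
  refine ⟨1 / k * (1 / k) * (1 / (p - k : ℕ)), mul_mem (mul_mem hmk hmk) hmk', ?_⟩
  rw [Nat.cast_sub hkp.le] at *
  field_simp
  ring

theorem inv_sub_modEq_one {p : ℕ} [hp : Fact p.Prime] {k : ℕ} (hk : 0 < k) (hkp : k < p) :
    PModEq p 1 (1 / ((p - k : ℕ) : ℚ)) (-(1 / k)) := by
  refine ((inv_sub_modEq hk hkp).mono one_le_two).trans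
    ⟨-(1 / k * (1 / k)), neg_mem (mul_mem (inv_mem_of_lt hk hkp) (inv_mem_of_lt hk hkp)), by ring⟩

theorem inv_sq_sub_modEq {p : ℕ} [hp : Fact p.Prime] {k : ℕ} (hk : 0 < k) (hkp : k < p) :
    PModEq p 1 (1 / ((p - k : ℕ) : ℚ) ^ 2) (1 / (k : ℚ) ^ 2) := by
  have h := inv_sub_modEq_one hk hkp
  have h1 := h.mul_left (inv_mem_of_lt (p := p) (k := p - k) (by omega) (by omega))
  have h2 := h.mul_right (neg_mem (inv_mem_of_lt (p := p) hk hkp))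
  exact (h1.add h2).of_eq (by ring)

theorem sum_Ico_one_reflect {M : Type*} [AddCommMonoid M] (f : ℕ → M) (p : ℕ) :
    ∑ k ∈ Finset.Ico 1 p, f (p - k) = ∑ k ∈ Finset.Ico 1 p, f k := by
  rw [Finset.sum_Ico_reflect f 1 (Nat.le_succ p)]
  simp

theorem harmonicBelow_prime_modEq {p : ℕ} [hp : Fact p.Prime] (hp5 : 5 < p) :
    PModEq p 2 (harmonicBelow p) 0 := by
  have h1 : PModEq p 2 (∑ k ∈ Finset.Ico 1 p, 1 / ((p - k : ℕ) : ℚ))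
      (∑ k ∈ Finset.Ico 1 p, (-(1 / (k : ℚ)) - p * (1 / (k : ℚ) ^ 2))) :=
    PModEq.sum _ fun k hk => by
      rw [Finset.mem_Ico] at hk
      exact inv_sub_modEq (by omega) hk.2
  rw [sum_Ico_one_reflect fun k : ℕ => 1 / (k : ℚ), Finset.sum_sub_distrib,
    Finset.sum_neg_distrib, ← Finset.mul_sum] at h1
  have h2 := (sum_inv_sq_modEq hp5).mul_pow 1
  have h3 : PModEq p 2 (2 * harmonicBelow p) 0 := (h1.sub h2).of_eq (by unfold harmonicBelow; ring)
  exact (h3.mul_left (inv_mem_of_lt (k := 2) (by omega) (by omega))).of_eq (by push_cast; ring)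

theorem harmonicBelow_sub_modEq {p : ℕ} [hp : Fact p.Prime] (hp5 : 5 < p) {k : ℕ} (hk : 0 < k)
    (hkp : k < p) : PModEq p 1 (harmonicBelow (p - k)) (harmonicBelow k + 1 / k) := by
  induction k, hk using Nat.le_induction with
  | base =>
    have h := (harmonicBelow_prime_modEq hp5).mono one_le_two
    have h2 := inv_sub_modEq_one (p := p) one_pos (by omega)
    obtain ⟨q, rfl⟩ : ∃ q, p = q + 2 := ⟨p - 2, by omega⟩
    have e : harmonicBelow (q + 2) = harmonicBelow (q + 1) + 1 / (q + 1 : ℕ) :=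
      Finset.sum_Ico_succ_top (by omega) _
    refine (h.sub h2).of_eq ?_
    rw [e]
    simp [harmonicBelow]
  | succ k hk ih =>
    have h := ih (by omega)
    have h2 := inv_sub_modEq_one (p := p) (k := k + 1) (by omega) hkp
    have e : harmonicBelow (p - k) = harmonicBelow (p - (k + 1)) + 1 / (p - (k + 1) : ℕ) := by
      rw [show p - k = (p - (k + 1)) + 1 by omega]
      exact Finset.sum_Ico_succ_top (by omega) _
    have e2 : harmonicBelow (k + 1) = harmonicBelow k + 1 / k := Finset.sum_Ico_succ_top hk _
    refine (h.sub h2).of_eq ?_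
    rw [e, e2]
    ring

/-! ### Binomial coefficients modulo p^3. -/

theorem choose_sub_one_eq_prod (n k : ℕ) (hk : 0 < k) :
    (-1 : ℚ) ^ k * (n.choose k : ℚ) =
      -(n / k * ∏ i ∈ Finset.Ico 1 k, (1 - n / (i : ℚ))) := by
  induction k, hk using Nat.le_induction with
  | base => simp
  | succ k hk ih =>
    have hk0 : (k : ℚ) ≠ 0 := by exact_mod_cast (show k ≠ 0 by omega)
    have hk1 : ((k : ℚ) + 1) ≠ 0 := by exact_mod_cast (show k + 1 ≠ 0 by omega)
    rw [Finset.prod_Ico_succ_top hk]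
    have h : ((n.choose (k + 1) : ℕ) : ℚ) * (k + 1) = n.choose k * (n - k) := by
      rcases le_or_gt k n with h | h
      · have := Nat.choose_succ_right_eq n k
        rw [← Nat.cast_sub h]
        exact_mod_cast this
      · rw [Nat.choose_eq_zero_of_lt h, Nat.choose_eq_zero_of_lt (by omega)]
        simp
    have h' : ((n.choose (k + 1) : ℕ) : ℚ) = n.choose k * (n - k) / (k + 1) := by
      field_simp
      exact h
    rw [h', pow_succ]
    have e : (-1 : ℚ) ^ k * -1 * (n.choose k * (n - k) / (k + 1)) =
      ((-1 : ℚ) ^ k * n.choose k) * (-(n - k) / (k + 1)) := by ring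
    rw [e, ih]
    push_cast
    field_simp
    ring

theorem choose_add_eq_prod (p k : ℕ) :
    ((p + k).choose p : ℚ) = ∏ i ∈ Finset.Ico 1 (k + 1), (1 + p / (i : ℚ)) := by
  induction k with
  | zero => simp
  | succ k ih =>
    rw [Finset.prod_Ico_succ_top (by omega), ← ih]
    have hk1 : ((k : ℚ) + 1) ≠ 0 := by exact_mod_cast (show k + 1 ≠ 0 by omega)
    have h := Nat.add_one_mul_choose_eq (p + k) k
    rw [← Nat.choose_symm_add (a := p) (b := k),
      ← Nat.choose_symm_of_eq_add (n := p + k + 1) (a := p) (b := k + 1) (by omega)] at h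
    have h' : ((p : ℚ) + k + 1) * (p + k).choose p = (p + k + 1).choose p * (k + 1) := by
      exact_mod_cast h
    rw [← add_assoc]
    push_cast
    field_simp
    linear_combination -h'

theorem harmonicBelow_succ {k : ℕ} (hk : 0 < k) :
    harmonicBelow (k + 1) = harmonicBelow k + 1 / k := Finset.sum_Ico_succ_top hk _

theorem prod_one_add_div_modEq {p : ℕ} [hp : Fact p.Prime] (a : ℤ) {k : ℕ} (hk : k ≤ p) :
    PModEq p 2 (∏ i ∈ Finset.Ico 1 k, (1 + a * p / (i : ℚ))) (1 + a * p * harmonicBelow k) := by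
  have h := PModEq.prod_one_add (p := p) (n := 1) (Finset.Ico 1 k)
    (f := fun i : ℕ => (a : ℚ) * (1 / i)) fun i hi => by
      rw [Finset.mem_Ico] at hi
      exact mul_mem (intCast_mem _ a) (inv_mem_of_lt (by omega) (by omega))
  rw [← Finset.mul_sum] at h
  have e : ∏ i ∈ Finset.Ico 1 k, (1 + a * p / (i : ℚ))
      = ∏ i ∈ Finset.Ico 1 k, (1 + (p : ℚ) ^ 1 * (a * (1 / i))) :=
    Finset.prod_congr rfl fun i _ => by ring
  rw [e]
  exact h.of_eq (by unfold harmonicBelow; ring)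

/-- `(1 / k) ∏_{i < k} (1 - a p / i)` up to multiples of `p ^ 2`. -/
def truncatedInv (p : ℕ) (a : ℚ) (k : ℕ) : ℚ := 1 / k * (1 - a * p * harmonicBelow k)

theorem truncatedInv_mem {p : ℕ} [hp : Fact p.Prime] (a : ℕ) {k : ℕ} (hk : 0 < k)
    (hkp : k < p) : truncatedInv p a k ∈ pIntegers p :=
  mul_mem (inv_mem_of_lt hk hkp) (sub_mem (one_mem _)
    (mul_mem (mul_mem (natCast_mem_pIntegers _) (natCast_mem_pIntegers _))
      (harmonicBelow_mem hkp.le)))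

theorem neg_one_pow_mul_choose_modEq {p : ℕ} [hp : Fact p.Prime] (a : ℕ) {k : ℕ} (hk : 0 < k)
    (hkp : k < p) :
    PModEq p 3 ((-1) ^ k * ((a * p).choose k : ℚ)) (-(a * p * truncatedInv p a k)) := by
  rw [choose_sub_one_eq_prod _ _ hk]
  have h := prod_one_add_div_modEq (p := p) (-a) hkp.le
  have h2 := ((h.mul_left (neg_mem (mul_mem (natCast_mem_pIntegers a)
    (inv_mem_of_lt hk hkp)))).mul_pow 1)
  have e : ∏ i ∈ Finset.Ico 1 k, (1 - ((a * p : ℕ) : ℚ) / (i : ℚ))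
      = ∏ i ∈ Finset.Ico 1 k, (1 + ((-(a : ℤ) : ℤ) : ℚ) * p / (i : ℚ)) :=
    Finset.prod_congr rfl fun i _ => by push_cast; ring
  rw [e]
  exact h2.of_eq (by unfold truncatedInv; push_cast; ring)

theorem neg_one_pow_prime {p : ℕ} [hp : Fact p.Prime] (hp5 : 5 < p) : (-1 : ℚ) ^ p = -1 :=
  Odd.neg_one_pow (hp.out.odd_of_ne_two (by omega))

/-- Wolstenholme's congruence. -/
theorem choose_mul_prime_modEq {p : ℕ} [hp : Fact p.Prime] (hp5 : 5 < p) (a : ℕ) :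
    PModEq p 3 ((a * p).choose p : ℚ) a := by
  have hp0 : (p : ℚ) ≠ 0 := by exact_mod_cast hp.out.ne_zero
  set X : ℚ := ∏ i ∈ Finset.Ico 1 p, (1 + ((-(a : ℤ) : ℤ) : ℚ) * p / (i : ℚ)) with hX
  have hC : ((a * p).choose p : ℚ) = a * X := by
    have h := choose_sub_one_eq_prod (a * p) p hp.out.pos
    rw [neg_one_pow_prime hp5] at h
    have e : X = ∏ i ∈ Finset.Ico 1 p, (1 - ((a * p : ℕ) : ℚ) / (i : ℚ)) :=
      Finset.prod_congr rfl fun i _ => by push_cast; ring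
    rw [← e] at h
    push_cast at h
    field_simp at h
    linear_combination -h
  obtain ⟨w, hw, hXw⟩ : ∃ w ∈ pIntegers p, X = 1 + p * w := by
    obtain ⟨z, hz, h⟩ := prod_one_add_div_modEq (p := p) (-a) le_rfl
    refine ⟨p * z - a * harmonicBelow p, sub_mem (mul_mem (natCast_mem_pIntegers p) hz)
      (mul_mem (natCast_mem_pIntegers a) (harmonicBelow_mem le_rfl)), ?_⟩
    rw [← hX] at h
    push_cast at h
    linear_combination h
  -- Pair i with p - i: since 1/i + 1/(p-i) = p/(i(p-i)), the two factors multiply to 1 + p^2 (a^2 -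
  -- a)/(i(p-i)), and the sum of 1/(i(p-i)) vanishes mod p.
  have hXX : PModEq p 3 (X * X) 1 := by
    have e : X * X = ∏ i ∈ Finset.Ico 1 p,
        (1 + (p : ℚ) ^ 2 * ((a ^ 2 - a) * (1 / i * (1 / (p - i : ℕ))))) := by
      have e1 : X = ∏ i ∈ Finset.Ico 1 p, (1 + ((-(a : ℤ) : ℤ) : ℚ) * p / ((p - i : ℕ) : ℚ)) := by
        rw [Finset.prod_Ico_reflect (fun i : ℕ => (1 + ((-(a : ℤ) : ℤ) : ℚ) * p / (i : ℚ))) 1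
          (Nat.le_succ p)]
        simp [hX]
      nth_rewrite 2 [e1]
      rw [hX, ← Finset.prod_mul_distrib]
      refine Finset.prod_congr rfl fun i hi => ?_
      rw [Finset.mem_Ico] at hi
      have h1 : (i : ℚ) ≠ 0 := by exact_mod_cast (show i ≠ 0 by omega)
      have h2 : ((p - i : ℕ) : ℚ) ≠ 0 := by exact_mod_cast (show p - i ≠ 0 by omega)
      rw [Nat.cast_sub hi.2.le] at *
      push_cast
      field_simp
      ring
    have hm : (a : ℚ) ^ 2 - a ∈ pIntegers p :=
      sub_mem (pow_mem (natCast_mem_pIntegers a) 2) (natCast_mem_pIntegers a)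
    have h1 : PModEq p 1 (∑ i ∈ Finset.Ico 1 p, ((a : ℚ) ^ 2 - a) * (1 / i * (1 / (p - i : ℕ)))) 0 := by
      have h3 : PModEq p 1 (∑ i ∈ Finset.Ico 1 p, ((1 : ℚ) / i * (1 / (p - i : ℕ))))
          (∑ i ∈ Finset.Ico 1 p, -((1 : ℚ) / i ^ 2)) := PModEq.sum _ fun i hi => by
        rw [Finset.mem_Ico] at hi
        exact ((inv_sub_modEq_one (p := p) (show 0 < i by omega) hi.2).mul_left
          (inv_mem_of_lt (p := p) (show 0 < i by omega) hi.2)).of_eq (by ring)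
      rw [Finset.sum_neg_distrib] at h3
      rw [← Finset.mul_sum]
      exact ((h3.sub (sum_inv_sq_modEq hp5)).mul_left hm).of_eq (by ring)
    rw [e]
    have h2 := PModEq.prod_one_add (p := p) (n := 2) (Finset.Ico 1 p)
      (f := fun i : ℕ => ((a : ℚ) ^ 2 - a) * (1 / i * (1 / (p - i : ℕ)))) fun i hi => by
        rw [Finset.mem_Ico] at hi
        exact mul_mem hm (mul_mem (inv_mem_of_lt (by omega) (by omega))
          (inv_mem_of_lt (by omega) (by omega)))
    exact (h2.mono (show 3 ≤ 2 + 2 by norm_num)).add (h1.mul_pow 2) |>.of_eq (by ring)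
  have h2 : (1 / ((2 : ℕ) : ℚ)) ∈ pIntegers p := inv_mem_of_lt (by norm_num) (by omega)
  -- As X + 1 = 2(1 + p w/2) is a unit, X^2 ≡ 1 forces X ≡ 1.
  obtain ⟨u, hu, hu1⟩ := exists_mul_one_add_eq_one (mul_mem h2 hw)
  push_cast at hu1 h2
  rw [hC]
  refine (hXX.mul_left (mul_mem (mul_mem (natCast_mem_pIntegers a) h2) hu)).of_eq ?_
  rw [hXw]
  linear_combination (a * p * w : ℚ) * hu1

/-- From C(4p,p+k) C(p+k,p) = C(4p,p) C(3p,k): the right side is known mod p^3, and C(p+k,p) ≡ 1 + p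
H_k mod p^2 is a unit. Dividing by it turns T_3 into T_4 - p/k^2. -/
theorem neg_one_pow_mul_choose_prime_add_modEq {p : ℕ} [hp : Fact p.Prime] (hp5 : 5 < p) {k : ℕ}
    (hk : 0 < k) (hkp : k < p) :
    PModEq p 3 ((-1) ^ (p + k) * ((4 * p).choose (p + k) : ℚ))
      (12 * p * (truncatedInv p 4 k - p * (1 / (k : ℚ) ^ 2))) := by
  have hk0 : (k : ℚ) ≠ 0 := by exact_mod_cast hk.ne'
  have hkm := inv_mem_of_lt (p := p) hk hkp
  have hH := harmonicBelow_mem (p := p) hkp.le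
  have hpm := natCast_mem_pIntegers (p := p) p
  have hn (n : ℕ) : (n : ℚ) ∈ pIntegers p := natCast_mem_pIntegers n
  have hmul : ((4 * p).choose (p + k) : ℚ) * (p + k).choose p
      = (4 * p).choose p * (3 * p).choose k := by
    have h := Nat.choose_mul (n := 4 * p) (Nat.le_add_right p k)
    rw [show 4 * p - p = 3 * p by omega, Nat.add_sub_cancel_left] at h
    exact_mod_cast h
  obtain ⟨c, hc, hC⟩ := choose_mul_prime_modEq hp5 4
  obtain ⟨d, hd, hD⟩ := neg_one_pow_mul_choose_modEq (p := p) 3 hk hkp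
  obtain ⟨y, hy, hY⟩ : PModEq p 2 ((p + k).choose p : ℚ) (1 + p * harmonicBelow (k + 1)) := by
    rw [choose_add_eq_prod]
    simpa using prod_one_add_div_modEq (p := p) 1 (k := k + 1) hkp
  rw [harmonicBelow_succ hk] at hY
  obtain ⟨u, hu, hu1⟩ := exists_mul_one_add_eq_one (p := p)
    (x := harmonicBelow k + 1 / k + p * y) (add_mem (add_mem hH hkm) (mul_mem hpm hy))
  have hY' : ((p + k).choose p : ℚ) = 1 + p * (harmonicBelow k + 1 / k + p * y) := by
    linear_combination hY
  set Y : ℚ := ((p + k).choose p : ℚ)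
  set H := harmonicBelow k
  set B : ℚ := ((4 * p).choose (p + k) : ℚ)
  set R : ℚ := 12 * p * (truncatedInv p 4 k - p * (1 / (k : ℚ) ^ 2)) with hR
  rw [← hY'] at hu1
  have hBY : (-1) ^ (p + k) * B * Y =
      -((4 * p).choose p * ((-1) ^ k * ((3 * p).choose k : ℚ))) := by
    rw [pow_add, neg_one_pow_prime hp5]
    linear_combination (-(-1) ^ k : ℚ) * hmul
  have hRY : PModEq p 3 (R * Y) (12 * p * truncatedInv p 3 k) := by
    refine ⟨12 * (1 / k) * (y * (1 - 4 * p * H - p * (1 / k)) - (4 * H + 1 / k) * (H + 1 / k)),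
      ?_, ?_⟩
    · have h12 := hn 12
      have h4 := hn 4
      push_cast at h12 h4
      exact mul_mem (mul_mem h12 hkm) (sub_mem (mul_mem hy (sub_mem (sub_mem (one_mem _)
        (mul_mem (mul_mem h4 hpm) hH)) (mul_mem hpm hkm)))
        (mul_mem (add_mem (mul_mem h4 hH) hkm) (add_mem hH hkm)))
    · rw [hR, hY']
      unfold truncatedInv
      ring
  have hBY' : PModEq p 3 ((-1) ^ (p + k) * B * Y) (12 * p * truncatedInv p 3 k) := by
    rw [hBY]
    have ht := truncatedInv_mem (p := p) 3 hk hkp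
    have h4 := hn 4
    have h3 := hn 3
    push_cast at ht h4 h3 hC hD
    refine ⟨c * (3 * p * truncatedInv p 3 k - p ^ 3 * d) - 4 * d, sub_mem (mul_mem hc (sub_mem
      (mul_mem (mul_mem h3 hpm) ht) (mul_mem (pow_mem hpm 3) hd))) (mul_mem h4 hd), ?_⟩
    have e1 : ((4 * p).choose p : ℚ) = 4 + p ^ 3 * c := by linear_combination hC
    have e2 : (-1) ^ k * ((3 * p).choose k : ℚ) = p ^ 3 * d - 3 * p * truncatedInv p 3 k := by
      linear_combination hD
    rw [e1, e2]
    ring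
  refine ((hBY'.trans hRY.symm).mul_left hu).of_eq ?_
  linear_combination ((-1) ^ (p + k) * B - R) * hu1

/-- This cancellation is the reason for pairing 2p with 4p. -/
theorem inv_eq_two_mul_truncatedInv_sub (p k : ℕ) :
    1 / (k : ℚ) = 2 * truncatedInv p 2 k - truncatedInv p 4 k := by
  unfold truncatedInv
  ring

theorem truncatedInv_sub_modEq {p : ℕ} [hp : Fact p.Prime] (hp5 : 5 < p) {k : ℕ} (hk : 0 < k)
    (hkp : k < p) :
    PModEq p 2 (truncatedInv p 4 (p - k)) (-truncatedInv p 4 k + 3 * p * (1 / (k : ℚ) ^ 2)) := by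
  have hkm := inv_mem_of_lt (p := p) hk hkp
  have hH := harmonicBelow_mem (p := p) hkp.le
  have hH' := harmonicBelow_mem (p := p) (Nat.sub_le p k)
  have h1 := inv_sub_modEq (p := p) hk hkp
  have h2 := ((inv_sub_modEq_one (p := p) hk hkp).mul_right hH').mul_pow 1
  have h3 := ((harmonicBelow_sub_modEq hp5 hk hkp).mul_left hkm).mul_pow 1
  have h4 : (4 : ℚ) ∈ pIntegers p := by exact_mod_cast natCast_mem_pIntegers (p := p) 4
  refine (h1.sub ((h2.sub h3).mul_left h4)).of_eq ?_
  unfold truncatedInv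
  ring

/-! ### Sums over residue classes modulo 5. -/

/-- The sum of `f k` over `1 ≤ k < p` in the residue class `s` modulo `5`. -/
def classSum (p : ℕ) (s : ZMod 5) (f : ℕ → ℚ) : ℚ :=
  ∑ k ∈ Finset.Ico 1 p, if (k : ZMod 5) = s then f k else 0

theorem classSum_modEq {p : ℕ} [hp : Fact p.Prime] {n : ℕ} {f g : ℕ → ℚ} (s : ZMod 5)
    (h : ∀ k, 0 < k → k < p → PModEq p n (f k) (g k)) :
    PModEq p n (classSum p s f) (classSum p s g) :=
  PModEq.sum _ fun k hk => by
    rw [Finset.mem_Ico] at hk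
    split_ifs
    · exact h k (by omega) hk.2
    · exact PModEq.refl _

theorem classSum_congr {p : ℕ} {f g : ℕ → ℚ} (s : ZMod 5)
    (h : ∀ k, 0 < k → k < p → f k = g k) : classSum p s f = classSum p s g :=
  Finset.sum_congr rfl fun k hk => by
    rw [Finset.mem_Ico] at hk
    rw [h k (by omega) hk.2]

theorem classSum_mul_left (p : ℕ) (s : ZMod 5) (c : ℚ) (f : ℕ → ℚ) :
    classSum p s (fun k => c * f k) = c * classSum p s f := by
  unfold classSum
  rw [Finset.mul_sum]
  exact Finset.sum_congr rfl fun k _ => by split_ifs <;> simp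

theorem classSum_add (p : ℕ) (s : ZMod 5) (f g : ℕ → ℚ) :
    classSum p s (fun k => f k + g k) = classSum p s f + classSum p s g := by
  unfold classSum
  rw [← Finset.sum_add_distrib]
  exact Finset.sum_congr rfl fun k _ => by split_ifs <;> simp

theorem classSum_reflect (p : ℕ) (s : ZMod 5) (f : ℕ → ℚ) :
    classSum p s (fun k => f (p - k)) = classSum p (p - s) f := by
  unfold classSum
  rw [← sum_Ico_one_reflect]
  refine Finset.sum_congr rfl fun k hk => ?_
  rw [Finset.mem_Ico] at hk
  simp only [Nat.cast_sub hk.2.le, Nat.sub_sub_self hk.2.le, sub_eq_iff_eq_add,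
    eq_sub_iff_add_eq, add_comm s, eq_comm]

theorem sum_classSum (p : ℕ) (f : ℕ → ℚ) :
    ∑ s : ZMod 5, classSum p s f = ∑ k ∈ Finset.Ico 1 p, f k := by
  unfold classSum
  rw [Finset.sum_comm]
  exact Finset.sum_congr rfl fun k _ => by simp

/-- Since p is invertible mod 5, its multiples label all the classes, which avoids a case split on p
mod 5 later. -/
theorem sum_multiples_classSum {p : ℕ} (hp : (p : ZMod 5) ≠ 0) (f : ℕ → ℚ) :
    classSum p 0 f + classSum p p f + classSum p (2 * p) f + classSum p (3 * p) f
      + classSum p (4 * p) f = ∑ k ∈ Finset.Ico 1 p, f k := by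
  rw [← sum_classSum]
  generalize (p : ZMod 5) = q at hp ⊢
  have key (F : ZMod 5 → ℚ) : ∑ s, F s = F 0 + F 1 + F 2 + F 3 + F 4 := by
    exact Fin.sum_univ_five F
  rw [key]
  have h : q = 1 ∨ q = 2 ∨ q = 3 ∨ q = 4 := by revert q; decide
  rcases h with rfl | rfl | rfl | rfl
  · simp only [mul_one]
  · rw [show (2 : ZMod 5) * 2 = 4 by decide, show (3 : ZMod 5) * 2 = 1 by decide,
      show (4 : ZMod 5) * 2 = 3 by decide]
    ring
  · rw [show (2 : ZMod 5) * 3 = 1 by decide, show (3 : ZMod 5) * 3 = 4 by decide,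
      show (4 : ZMod 5) * 3 = 2 by decide]
    ring
  · rw [show (2 : ZMod 5) * 4 = 3 by decide, show (3 : ZMod 5) * 4 = 2 by decide,
      show (4 : ZMod 5) * 4 = 1 by decide]
    ring

/-! ### Alternating binomial sums and Fibonacci numbers. -/

/-- The alternating sum of the binomial coefficients `n.choose k` over a class modulo `5`. -/
def altChooseSum (n : ℕ) (s : ZMod 5) : ℤ :=
  ∑ k ∈ Finset.range (n + 1), if (k : ZMod 5) = s then (-1) ^ k * (n.choose k : ℤ) else 0

theorem altChooseSum_succ (n : ℕ) (s : ZMod 5) :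
    altChooseSum (n + 1) s = altChooseSum n s - altChooseSum n (s - 1) := by
  have h1 : altChooseSum n s = ∑ k ∈ Finset.range (n + 1 + 1),
      if (k : ZMod 5) = s then (-1) ^ k * (n.choose k : ℤ) else 0 := by
    rw [Finset.sum_range_succ _ (n + 1)]
    simp [altChooseSum]
  rw [h1]
  unfold altChooseSum
  rw [Finset.sum_range_succ' _ (n + 1), Finset.sum_range_succ' _ (n + 1), add_sub_right_comm,
    ← Finset.sum_sub_distrib]
  simp only [Nat.choose_zero_right]
  congr 1
  refine Finset.sum_congr rfl fun k _ => ?_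
  have : ((k + 1 : ℕ) : ZMod 5) = s ↔ (k : ZMod 5) = s - 1 := by
    rw [eq_sub_iff_add_eq, Nat.cast_succ]
  simp only [this]
  split_ifs
  · rw [Nat.choose_succ_succ]
    push_cast
    ring
  · simp

theorem altChooseSum_add_two (n : ℕ) (s : ZMod 5) :
    altChooseSum (n + 2) s
      = altChooseSum n s - 2 * altChooseSum n (s - 1) + altChooseSum n (s - 2) := by
  rw [altChooseSum_succ, altChooseSum_succ, altChooseSum_succ, sub_sub s,
    show (1 : ZMod 5) + 1 = 2 by decide]
  ring

theorem altChooseSum_add_four (n : ℕ) (s : ZMod 5) :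
    altChooseSum (n + 4) s
      = altChooseSum n s - 4 * altChooseSum n (s - 1) + 6 * altChooseSum n (s - 2)
        - 4 * altChooseSum n (s - 3) + altChooseSum n (s - 4) := by
  rw [altChooseSum_add_two (n + 2), altChooseSum_add_two, altChooseSum_add_two,
    altChooseSum_add_two]
  simp only [sub_sub]
  rw [show (1 : ZMod 5) + 1 = 2 by decide, show (1 : ZMod 5) + 2 = 3 by decide,
    show (2 : ZMod 5) + 1 = 3 by decide, show (2 : ZMod 5) + 2 = 4 by decide]
  ring

/-- The sums for `4 * m`, indexed from the middle class `2 * m`, in terms of Fibonacci numbers. -/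
theorem altChooseSum_four_mul (m : ℕ) :
    let f : ZMod 5 → ℤ := fun r => altChooseSum (4 * (m + 1)) (2 * (m + 1) + r)
    f 4 = f 1 ∧ f 3 = f 2 ∧ f 0 + 2 * f 1 + 2 * f 2 = 0 ∧
      3 * f 2 + 2 * f 1 = -(5 ^ (m + 1) * Nat.fib (2 * m + 1)) ∧
      3 * f 1 + 2 * f 2 = -(5 ^ (m + 1) * Nat.fib (2 * m + 3)) := by
  induction m with
  | zero => decide
  | succ m ih =>
    intro f
    set g : ZMod 5 → ℤ := fun r => altChooseSum (4 * (m + 1)) (2 * (m + 1) + r) with hg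
    -- Passing from m to m + 1 multiplies by (1 - x)^4 modulo x^5 - 1 and moves the centre by 2, so
    -- the recurrence is symmetric in r.
    have step (r : ZMod 5) : f r = g (r + 2) - 4 * g (r + 1) + 6 * g r - 4 * g (r - 1)
        + g (r - 2) := by
      simp only [f, hg]
      rw [show 4 * (m + 1 + 1) = 4 * (m + 1) + 4 by ring, altChooseSum_add_four]
      push_cast
      ring_nf
    obtain ⟨h4, h3, h0, hu, hv⟩ := ih
    have e0 : f 0 = g 2 - 4 * g 1 + 6 * g 0 - 4 * g 4 + g 3 := step 0
    have e1 : f 1 = g 3 - 4 * g 2 + 6 * g 1 - 4 * g 0 + g 4 := step 1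
    have e2 : f 2 = g 4 - 4 * g 3 + 6 * g 2 - 4 * g 1 + g 0 := step 2
    have e3 : f 3 = g 0 - 4 * g 4 + 6 * g 3 - 4 * g 2 + g 1 := step 3
    have e4 : f 4 = g 1 - 4 * g 0 + 6 * g 4 - 4 * g 3 + g 2 := step 4
    change g 4 = g 1 at h4
    change g 3 = g 2 at h3
    change g 0 + 2 * g 1 + 2 * g 2 = 0 at h0
    change 3 * g 2 + 2 * g 1 = _ at hu
    change 3 * g 1 + 2 * g 2 = _ at hv
    have hF : (Nat.fib (2 * (m + 1) + 3) : ℤ) = 3 * Nat.fib (2 * m + 3) - Nat.fib (2 * m + 1) := by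
      have a1 : Nat.fib (2 * (m + 1) + 3) = Nat.fib (2 * m + 3) + Nat.fib (2 * m + 4) :=
        Nat.fib_add_two
      have a2 : Nat.fib (2 * m + 4) = Nat.fib (2 * m + 2) + Nat.fib (2 * m + 3) := Nat.fib_add_two
      have a3 : Nat.fib (2 * m + 3) = Nat.fib (2 * m + 1) + Nat.fib (2 * m + 2) := Nat.fib_add_two
      push_cast [a1, a2]
      linear_combination (-1 : ℤ) * (by exact_mod_cast a3 : (Nat.fib (2 * m + 3) : ℤ)
        = Nat.fib (2 * m + 1) + Nat.fib (2 * m + 2))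
    rw [hF, show 2 * (m + 1) + 1 = 2 * m + 3 by ring, pow_succ]
    rw [e0, e1, e2, e3, e4, h4, h3]
    refine ⟨by ring, by ring, by ring, ?_, ?_⟩
    · linear_combination 5 * hv - 5 * h0
    · linear_combination 15 * hv - 5 * hu - 10 * h0

/-! ### Splitting the sums for 2p and 4p into blocks of length p. -/

theorem sum_Ico_class_add (p a : ℕ) (s : ZMod 5) (g : ℕ → ℚ) :
    ∑ k ∈ Finset.Ico 1 p, (if ((a + k : ℕ) : ZMod 5) = s then g (a + k) else 0)
      = classSum p (s - a) (fun k => g (a + k)) :=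
  Finset.sum_congr rfl fun k _ => by
    simp only [Nat.cast_add, eq_sub_iff_add_eq, add_comm (k : ZMod 5)]

/-- Indexing a block from its upper end prepares for the symmetry C(n,k) = C(n,n-k). -/
theorem sum_Ico_class_add_reflect (p a : ℕ) (s : ZMod 5) (g : ℕ → ℚ) :
    ∑ k ∈ Finset.Ico 1 p, (if ((a + k : ℕ) : ZMod 5) = s then g (a + k) else 0)
      = classSum p (a + p - s) (fun k => g (a + p - k)) := by
  rw [sum_Ico_class_add, show (a : ZMod 5) + p - s = p - (s - a) by ring, ← classSum_reflect]
  refine classSum_congr _ fun k _ hk => ?_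
  rw [show a + p - (p - k) = a + k by omega]

theorem neg_one_pow_mul_choose_symm {n k : ℕ} (hn : Even n) (hk : k ≤ n) :
    (-1 : ℚ) ^ (n - k) * (n.choose (n - k) : ℚ) = (-1) ^ k * (n.choose k : ℚ) := by
  rw [Nat.choose_symm hk]
  congr 1
  have h : (-1 : ℚ) ^ (n - k) * (-1) ^ k = 1 := by
    rw [← pow_add, Nat.sub_add_cancel hk, hn.neg_one_pow]
  have h' : (-1 : ℚ) ^ k * (-1) ^ k = 1 := by rw [← mul_pow]; simp
  linear_combination (-1 : ℚ) ^ k * h - (-1) ^ (n - k) * h'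

theorem sum_range_mul_class {p : ℕ} (hp : 0 < p) (m : ℕ) (f : ℕ → ℚ) :
    ∑ k ∈ Finset.range (m * p), f k =
      ∑ a ∈ Finset.range m, (f (a * p) + ∑ k ∈ Finset.Ico 1 p, f (a * p + k)) := by
  induction m with
  | zero => simp
  | succ m ih =>
    rw [Nat.succ_mul, Finset.sum_range_add, ih, Finset.sum_range_succ,
      Finset.sum_range_eq_add_Ico _ hp, add_zero]

theorem altChooseSum_cast (n : ℕ) (s : ZMod 5) : (altChooseSum n s : ℚ) =
    ∑ k ∈ Finset.range (n + 1), if (k : ZMod 5) = s then (-1) ^ k * (n.choose k : ℚ) else 0 := by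
  unfold altChooseSum
  push_cast
  exact Finset.sum_congr rfl fun k _ => by split_ifs <;> simp

theorem altChooseSum_two_mul_prime {p : ℕ} [hp : Fact p.Prime] (hp5 : 5 < p)
    (hp0 : (p : ZMod 5) ≠ 0) :
    (altChooseSum (2 * p) p : ℚ) =
      2 * classSum p p (fun k => (-1) ^ k * ((2 * p).choose k : ℚ)) - (2 * p).choose p := by
  rw [altChooseSum_cast, Finset.sum_range_succ,
    sum_range_mul_class hp.out.pos 2 (fun k : ℕ => if (k : ZMod 5) = (p : ZMod 5) then
      (-1) ^ k * ((2 * p).choose k : ℚ) else 0)]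
  simp only [Finset.sum_range_succ, Finset.sum_range_zero, zero_add, zero_mul, one_mul]
  rw [sum_Ico_class_add_reflect p p p fun k => (-1) ^ k * ((2 * p).choose k : ℚ)]
  have h1 : classSum p p (fun k => (-1) ^ (p + p - k) * ((2 * p).choose (p + p - k) : ℚ))
      = classSum p p (fun k => (-1) ^ k * ((2 * p).choose k : ℚ)) :=
    classSum_congr _ fun k _ hk => by
      rw [← two_mul]
      exact neg_one_pow_mul_choose_symm (even_two_mul p) (by omega)
  have h2 : ((2 * p : ℕ) : ZMod 5) ≠ p := by
    push_cast
    intro h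
    exact hp0 (by linear_combination h)
  rw [if_neg (by simpa using hp0.symm), if_pos trivial, if_neg h2, neg_one_pow_prime hp5,
    add_sub_cancel_right, h1]
  change 0 + classSum p p _ + (_ + _) + 0 = _
  ring

/-- The isolated terms come from the multiples of p; the upper two of the four blocks are folded
onto the lower two. -/
theorem altChooseSum_four_mul_prime {p : ℕ} [hp : Fact p.Prime] (hp5 : 5 < p) (s : ZMod 5) :
    let a : ℕ → ℚ := fun k => (-1) ^ k * ((4 * p).choose k : ℚ)
    let b : ℕ → ℚ := fun k => (-1) ^ (p + k) * ((4 * p).choose (p + k) : ℚ)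
    (altChooseSum (4 * p) s : ℚ) =
      (if (0 : ZMod 5) = s then 1 else 0) - (if (p : ZMod 5) = s then ((4 * p).choose p : ℚ) else 0)
      + (if (2 * p : ZMod 5) = s then ((4 * p).choose (2 * p) : ℚ) else 0)
      - (if (3 * p : ZMod 5) = s then ((4 * p).choose p : ℚ) else 0)
      + (if (4 * p : ZMod 5) = s then 1 else 0)
      + classSum p s a + classSum p (s - p) b + classSum p (3 * p - s) b
      + classSum p (4 * p - s) a := by
  intro a b
  have hodd := neg_one_pow_prime hp5
  rw [altChooseSum_cast, Finset.sum_range_succ,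
    sum_range_mul_class hp.out.pos 4 (fun k : ℕ => if (k : ZMod 5) = s then
      (-1) ^ k * ((4 * p).choose k : ℚ) else 0)]
  simp only [Finset.sum_range_succ, Finset.sum_range_zero, zero_add, zero_mul, one_mul]
  have hsymm {k : ℕ} (hk : k ≤ 4 * p) : (-1 : ℚ) ^ (4 * p - k) * ((4 * p).choose (4 * p - k) : ℚ)
      = (-1) ^ k * ((4 * p).choose k : ℚ) :=
    neg_one_pow_mul_choose_symm (⟨2 * p, by ring⟩) hk
  have h2 : classSum p ((2 * p : ℕ) + p - s)
      (fun k => (-1) ^ (2 * p + p - k) * ((4 * p).choose (2 * p + p - k) : ℚ))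
      = classSum p (3 * p - s) b := by
    rw [show ((2 * p : ℕ) : ZMod 5) + p - s = 3 * p - s by push_cast; ring]
    exact classSum_congr _ fun k _ hk => by
      rw [show 2 * p + p - k = 4 * p - (p + k) by omega]
      exact hsymm (by omega)
  have h3 : classSum p ((3 * p : ℕ) + p - s)
      (fun k => (-1) ^ (3 * p + p - k) * ((4 * p).choose (3 * p + p - k) : ℚ))
      = classSum p (4 * p - s) a := by
    rw [show ((3 * p : ℕ) : ZMod 5) + p - s = 4 * p - s by push_cast; ring]
    exact classSum_congr _ fun k _ hk => by
      rw [show 3 * p + p - k = 4 * p - k by omega]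
      exact hsymm (by omega)
  rw [sum_Ico_class_add p p s fun k => (-1) ^ k * ((4 * p).choose k : ℚ),
    sum_Ico_class_add_reflect p (2 * p) s fun k => (-1) ^ k * ((4 * p).choose k : ℚ),
    sum_Ico_class_add_reflect p (3 * p) s fun k => (-1) ^ k * ((4 * p).choose k : ℚ), h2, h3]
  have e3 : (-1 : ℚ) ^ (3 * p) * ((4 * p).choose (3 * p) : ℚ) = -((4 * p).choose p) := by
    rw [show 3 * p = 4 * p - p by omega, hsymm (by omega), hodd]
    ring
  have e2 : (-1 : ℚ) ^ (2 * p) = 1 := (even_two_mul p).neg_one_pow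
  have e4 : (-1 : ℚ) ^ (4 * p) = 1 := Even.neg_one_pow ⟨2 * p, by ring⟩
  rw [e3, e2, e4, hodd]
  change _ + classSum p s a + (_ + classSum p (s - p) b) + _ + _ + _ = _
  simp only [Nat.cast_zero, Nat.choose_self, Nat.choose_zero_right, pow_zero, Nat.cast_mul,
    Nat.cast_ofNat, Nat.cast_one, one_mul, neg_one_mul]
  split_ifs <;> ring

/-! ### Evaluation at the prime p. -/

theorem natCast_zmod_five_ne_zero {p : ℕ} [hp : Fact p.Prime] (hp5 : 5 < p) :
    (p : ZMod 5) ≠ 0 := by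
  rw [Ne, ZMod.natCast_eq_zero_iff, Nat.prime_dvd_prime_iff_eq Nat.prime_five hp.out]
  omega

theorem lacunaryHarmonic_eq_classSum {p : ℕ} (hp : 0 < p) :
    lacunaryHarmonic p 5 (p - 1) = classSum p p (fun k => 1 / (k : ℚ)) := by
  unfold lacunaryHarmonic classSum
  rw [Finset.sum_filter]
  have : Finset.Icc 1 (p - 1) = Finset.Ico 1 p := by
    ext k
    simp only [Finset.mem_Icc, Finset.mem_Ico]
    omega
  rw [this]
  refine Finset.sum_congr rfl fun k _ => ?_
  have h := ZMod.intCast_eq_intCast_iff (k : ℤ) p 5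
  simp only [Int.cast_natCast] at h
  simp only [h]

theorem altChooseSum_two_mul_prime_eq_fib {p : ℕ} [hp : Fact p.Prime] (hp5 : 5 < p) :
    altChooseSum (2 * p) p = -(2 * 5 ^ ((p - 1) / 2) * Nat.fib p) := by
  obtain ⟨m, rfl⟩ : ∃ m, p = 2 * (m + 1) + 1 := by
    obtain ⟨k, hk⟩ := hp.out.odd_of_ne_two (by omega)
    exact ⟨k - 1, by omega⟩
  obtain ⟨h4, h3, h0, hu, hv⟩ := altChooseSum_four_mul m
  rw [show 2 * (2 * (m + 1) + 1) = 4 * (m + 1) + 2 by ring, altChooseSum_add_two,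
    show ((2 * (m + 1) + 1 : ℕ) : ZMod 5) = 2 * (m + 1) + 1 by push_cast; ring,
    show (2 * (m + 1) + 1 : ZMod 5) - 1 = 2 * (m + 1) + 0 by ring,
    show (2 * (m + 1) + 1 : ZMod 5) - 2 = 2 * (m + 1) + 4 by
      rw [show (4 : ZMod 5) = -1 by decide]; ring,
    show (2 * (m + 1) + 1 - 1) / 2 = m + 1 by omega, show 2 * (m + 1) + 1 = 2 * m + 3 by ring]
  linear_combination h4 + 2 * hv - 2 * h0

instance fact_prime_five : Fact (Nat.Prime 5) := ⟨Nat.prime_five⟩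

/-- Relative to the centre 2p, the classes 0 and p lie at distances 2 and 1 if p ≡ ±1 mod 5, and at
distances 1 and 2 if p ≡ ±2. This selects the index 2p - 1 or 2p + 1, and quadratic reciprocity
identifies the sign with the Legendre symbol. -/
theorem altChooseSum_four_mul_prime_eq_fib {p : ℕ} [hp : Fact p.Prime] (hp5 : 5 < p) :
    3 * altChooseSum (4 * p) 0 + 2 * altChooseSum (4 * p) p =
      -(5 ^ p * Nat.fib (2 * (p : ℤ) - legendreSym p 5).toNat) := by
  have hL : legendreSym p 5 = quadraticChar (ZMod 5) (p : ZMod 5) := by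
    have h := legendreSym.quadratic_reciprocity_one_mod_four (p := 5) (q := p) (by norm_num)
      (by omega)
    have h' : legendreSym 5 p = quadraticChar (ZMod 5) (p : ZMod 5) := by
      simp [legendreSym]
    rw [← h', ← h]
    rfl
  have h0 := natCast_zmod_five_ne_zero hp5
  have hc : (p : ZMod 5) = 1 ∨ (p : ZMod 5) = 2 ∨ (p : ZMod 5) = 3 ∨ (p : ZMod 5) = 4 := by
    generalize (p : ZMod 5) = q at h0
    revert q
    decide
  obtain ⟨h4, h3, -, hu, hv⟩ := altChooseSum_four_mul (p - 1)
  have hp1 : p - 1 + 1 = p := by omega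
  have hcast : ((p - 1 : ℕ) : ZMod 5) + 1 = p := by
    rw [← Nat.cast_succ]
    congr 1
  have f1 : 2 * (p - 1) + 1 = 2 * p - 1 := by omega
  have f2 : 2 * (p - 1) + 3 = 2 * p + 1 := by omega
  rw [hp1, hcast] at h4 h3 hu hv
  beta_reduce at h4 h3 hu hv
  rw [f1] at hu
  rw [f2] at hv
  have t1 : (2 * (p : ℤ) - 1).toNat = 2 * p - 1 := by omega
  have t2 : (2 * (p : ℤ) - -1).toNat = 2 * p + 1 := by omega
  rw [hL]
  rcases hc with h | h | h | h <;> rw [h] at h4 h3 hu hv ⊢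
  · rw [show quadraticChar (ZMod 5) 1 = 1 by decide, t1]
    rw [show (2 : ZMod 5) * 1 + 3 = 0 by decide, show (2 : ZMod 5) * 1 + 2 = 4 by decide] at h3
    rw [show (2 : ZMod 5) * 1 + 4 = 1 by decide, show (2 : ZMod 5) * 1 + 1 = 3 by decide] at h4
    rw [show (2 : ZMod 5) * 1 + 2 = 4 by decide, show (2 : ZMod 5) * 1 + 1 = 3 by decide] at hu
    linear_combination hu + 3 * h3 + 2 * h4
  · rw [show quadraticChar (ZMod 5) 2 = -1 by decide, t2]
    rw [show (2 : ZMod 5) * 2 + 3 = 2 by decide, show (2 : ZMod 5) * 2 + 2 = 1 by decide] at h3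
    rw [show (2 : ZMod 5) * 2 + 2 = 1 by decide, show (2 : ZMod 5) * 2 + 1 = 0 by decide] at hv
    linear_combination hv + 2 * h3
  · rw [show quadraticChar (ZMod 5) 3 = -1 by decide, t2]
    rw [show (2 : ZMod 5) * 3 + 4 = 0 by decide, show (2 : ZMod 5) * 3 + 1 = 2 by decide] at h4
    rw [show (2 : ZMod 5) * 3 + 2 = 3 by decide, show (2 : ZMod 5) * 3 + 1 = 2 by decide] at hv
    linear_combination hv + 3 * h4
  · rw [show quadraticChar (ZMod 5) 4 = 1 by decide, t1]
    rw [show (2 : ZMod 5) * 4 + 2 = 0 by decide, show (2 : ZMod 5) * 4 + 1 = 4 by decide] at hu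
    linear_combination hu

theorem classSum_truncatedInv_two_modEq {p : ℕ} [hp : Fact p.Prime] (hp5 : 5 < p) :
    PModEq p 2 (2 * classSum p p (truncatedInv p 2))
      (((5 : ℚ) ^ ((p - 1) / 2) * (Nat.fib p : ℚ) - 1) / p) := by
  have hp0 : (p : ℚ) ≠ 0 := by exact_mod_cast hp.out.ne_zero
  have h0 := natCast_zmod_five_ne_zero hp5
  have h1 := altChooseSum_two_mul_prime hp5 h0
  rw [altChooseSum_two_mul_prime_eq_fib hp5] at h1
  have h2 : PModEq p 3 (classSum p p (fun k => (-1) ^ k * ((2 * p).choose k : ℚ)))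
      (classSum p p (fun k => -(2 * p) * truncatedInv p 2 k)) :=
    classSum_modEq _ fun k hk hkp =>
      (neg_one_pow_mul_choose_modEq (p := p) 2 hk hkp).of_eq (by push_cast; ring)
  rw [classSum_mul_left] at h2
  have h3 := choose_mul_prime_modEq hp5 2
  have hm := inv_mem_of_lt (p := p) (k := 2) (by norm_num) (by omega)
  -- Dividing by p costs one power, which is why the binomials are needed mod p^3.
  refine PModEq.of_mul_pow 1 ((h2.sub (h3.mul_left hm)).of_eq ?_)
  push_cast at h1 ⊢
  field_simp
  linear_combination -h1

theorem classSum_truncatedInv_four_modEq {p : ℕ} [hp : Fact p.Prime] (hp5 : 5 < p) :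
    PModEq p 2 (classSum p p (truncatedInv p 4))
      (((5 : ℚ) ^ (p - 1) * (Nat.fib (2 * (p : ℤ) - legendreSym p 5).toNat : ℚ) - 1)
            / (4 * (p : ℚ))) := by
  have hp0 : (p : ℚ) ≠ 0 := by exact_mod_cast hp.out.ne_zero
  have hq := natCast_zmod_five_ne_zero hp5
  have hfib := altChooseSum_four_mul_prime_eq_fib hp5
  have h0 := altChooseSum_four_mul_prime hp5 0
  have h1 := altChooseSum_four_mul_prime hp5 p
  have hn (n : ℕ) : (n : ℚ) ∈ pIntegers p := natCast_mem_pIntegers n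
  have hpz : (p : ZMod 5) ≠ 0 ∧ (2 * p : ZMod 5) ≠ 0 ∧ (3 * p : ZMod 5) ≠ 0 ∧
      (4 * p : ZMod 5) ≠ 0 ∧ (0 : ZMod 5) ≠ p ∧ (2 * p : ZMod 5) ≠ p ∧ (3 * p : ZMod 5) ≠ p ∧
      (4 * p : ZMod 5) ≠ p ∧ (0 - p : ZMod 5) = 4 * p := by
    generalize (p : ZMod 5) = q at hq
    revert q
    decide
  obtain ⟨n1, n2, n3, n4, m0, m2, m3, m4, e⟩ := hpz
  simp only [if_neg n1, if_neg n2, if_neg n3, if_neg n4, if_true, e, sub_zero] at h0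
  simp only [if_neg m0, if_neg m2, if_neg m3, if_neg m4, if_true, sub_self,
    show (3 * p - p : ZMod 5) = 2 * p by ring, show (4 * p - p : ZMod 5) = 3 * p by ring] at h1
  set G : ZMod 5 → ℚ := fun s => classSum p s (truncatedInv p 4) with hG
  set E : ZMod 5 → ℚ := fun s => classSum p s (fun k => 1 / (k : ℚ) ^ 2) with hE
  have ha (s : ZMod 5) : PModEq p 3 (classSum p s fun k => (-1) ^ k * ((4 * p).choose k : ℚ))
      (-(4 * p * G s)) := by
    have h : PModEq p 3 (classSum p s fun k => (-1) ^ k * ((4 * p).choose k : ℚ))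
        (classSum p s fun k => -(4 * p) * truncatedInv p 4 k) :=
      classSum_modEq _ fun k hk hkp =>
        (neg_one_pow_mul_choose_modEq (p := p) 4 hk hkp).of_eq (by push_cast; ring)
    rw [classSum_mul_left] at h
    exact h.of_eq (by ring)
  have hb (s : ZMod 5) :
      PModEq p 3 (classSum p s fun k => (-1) ^ (p + k) * ((4 * p).choose (p + k) : ℚ))
        (12 * p * (G s - p * E s)) := by
    have h : PModEq p 3 (classSum p s fun k => (-1) ^ (p + k) * ((4 * p).choose (p + k) : ℚ))
        (classSum p s fun k => 12 * p * (truncatedInv p 4 k + (-p) * (1 / (k : ℚ) ^ 2))) :=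
      classSum_modEq _ fun k hk hkp =>
        (neg_one_pow_mul_choose_prime_add_modEq hp5 hk hkp).of_eq (by ring)
    rw [classSum_mul_left, classSum_add, classSum_mul_left] at h
    exact h.of_eq (by ring)
  have hGr (s : ZMod 5) : PModEq p 2 (G (p - s)) (-G s + 3 * p * E s) := by
    have h : PModEq p 2 (classSum p s fun k => truncatedInv p 4 (p - k))
        (classSum p s fun k => -1 * truncatedInv p 4 k + 3 * p * (1 / (k : ℚ) ^ 2)) :=
      classSum_modEq _ fun k hk hkp => (truncatedInv_sub_modEq hp5 hk hkp).of_eq (by ring)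
    rw [classSum_reflect, classSum_add, classSum_mul_left, classSum_mul_left] at h
    exact h.of_eq (by ring)
  have hEr (s : ZMod 5) : PModEq p 1 (E (p - s)) (E s) := by
    have h : PModEq p 1 (classSum p s fun k => 1 / ((p - k : ℕ) : ℚ) ^ 2)
        (classSum p s fun k => 1 / (k : ℚ) ^ 2) :=
      classSum_modEq _ fun k hk hkp => inv_sq_sub_modEq hk hkp
    rwa [classSum_reflect p s fun k => 1 / (k : ℚ) ^ 2] at h
  have hEs : PModEq p 1 (E 0 + E p + E (2 * p) + E (3 * p) + E (4 * p)) 0 := by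
    have h := sum_inv_sq_modEq hp5
    rwa [← sum_multiples_classSum hq] at h
  have r1 : (p - p : ZMod 5) = 0 := sub_self _
  have r2 : (p - 2 * p : ZMod 5) = 4 * p := by
    generalize (p : ZMod 5) = q
    revert q
    decide
  have r3 : (p - 3 * p : ZMod 5) = 3 * p := by
    generalize (p : ZMod 5) = q
    revert q
    decide
  have G1 := hGr p
  have G2 := hGr (2 * p)
  have G3 := hGr (3 * p)
  have E1 := hEr p
  have E2 := hEr (2 * p)
  rw [r1] at G1 E1
  rw [r2] at G2 E2
  rw [r3] at G3
  have hC := choose_mul_prime_modEq hp5 4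
  have hfibQ : (3 * altChooseSum (4 * p) 0 + 2 * altChooseSum (4 * p) p : ℚ) =
      -(5 ^ p * Nat.fib (2 * (p : ℤ) - legendreSym p 5).toNat) := by exact_mod_cast hfib
  rw [h0, h1] at hfibQ
  have hunit : (1 / 2 * (1 / 4) * (1 / 5) : ℚ) ∈ pIntegers p := by
    have h2 := inv_mem_of_lt (p := p) (k := 2) (by norm_num) (by omega)
    have h4 := inv_mem_of_lt (p := p) (k := 4) (by norm_num) (by omega)
    have h5 := inv_mem_of_lt (p := p) (k := 5) (by norm_num) (by omega)
    exact mul_mem (mul_mem (by exact_mod_cast h2) (by exact_mod_cast h4)) (by exact_mod_cast h5)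
  -- The weights 6 and 4 are twice the 3 and 2 of the Fibonacci identity; the doubling keeps the
  -- multipliers below integral.
  have hA := ((((ha 0).add (ha (4 * p))).add ((hb (4 * p)).add (hb (3 * p)))).mul_left (hn 6)).add
    (((((ha p).add (ha (3 * p))).add ((hb 0).add (hb (2 * p)))).sub hC).mul_left (hn 4))
  -- The multipliers 6, 12, 7 eliminate every class sum of T_4 but that of p. Those of `hX1` cancel
  -- the remaining sums of 1/k^2. What is left is -40 p times the wanted sum, hence the unit 1/40.
  have hX2 := ((G1.mul_left (hn 6)).add (G2.mul_left (hn 12))).add (G3.mul_left (hn 7))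
  have hX1 := ((hEs.mul_left (hn 3)).sub ((E1.mul_left (hn 15)).add (E2.mul_left (hn 21)))).mul_pow 1
  have hX := ((hX2.add hX1).mul_pow 1).mul_left (hn 4)
  refine PModEq.of_mul_pow 1 (((hA.add hX).mul_left hunit).of_eq ?_)
  have hpow : (5 : ℚ) ^ p = 5 * 5 ^ (p - 1) := by
    rw [← pow_succ', Nat.sub_add_cancel hp.out.one_le]
  rw [hpow] at hfibQ
  generalize (2 * p : ZMod 5) = c₂, (3 * p : ZMod 5) = c₃, (4 * p : ZMod 5) = c₄ at hfibQ ⊢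
  field_simp
  push_cast
  linear_combination 2 * hfibQ

theorem theorem3 (p : ℕ) [Fact p.Prime] (hp : 5 < p) :
    RatModEq (p ^ 2) (lacunaryHarmonic (p : ℤ) 5 (p - 1))
      (((5 : ℚ) ^ ((p - 1) / 2) * (Nat.fib p : ℚ) - 1) / (p : ℚ)
        - ((5 : ℚ) ^ (p - 1) * (Nat.fib (2 * (p : ℤ) - legendreSym p 5).toNat : ℚ) - 1)
            / (4 * (p : ℚ))) := by
  apply PModEq.ratModEq
  rw [lacunaryHarmonic_eq_classSum (by omega)]
  have e : classSum p p (fun k => 1 / (k : ℚ)) =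
      2 * classSum p p (truncatedInv p 2) - classSum p p (truncatedInv p 4) := by
    rw [← classSum_mul_left, sub_eq_add_neg, neg_eq_neg_one_mul, ← classSum_mul_left,
      ← classSum_add]
    exact classSum_congr _ fun k _ _ => by
      rw [inv_eq_two_mul_truncatedInv_sub p k]
      ring
  rw [e]
  exact (classSum_truncatedInv_two_modEq hp).sub (classSum_truncatedInv_four_modEq hp)
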